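/- For an integer $n \ge 2$ and $p \in [0, \frac1n]$ let $v_n(p) = (1-(n-1)p,\, p, \dots, p)$, a probability vector with $n$ entries. For a probability vector $x = (x_1, \dots, x_n)$ let $H(x) = -\sum_{i=1}^n x_i \ln x_i$ (with $0 \ln 0 = 0$) and, for real $\alpha > 0$, $\|x\|_\alpha = \left( \sum_{i=1}^n x_i^\alpha \right)^{1/\alpha}$. Write $H_{v_n}(p) = H(v_n(p))$; it maps $[0, \frac1n]$ bijectively onto $[0, \ln n]$, so that, for $p \in [0, \frac1n]$, $\|v_n(p)\|_\alpha$ is a function of $H_{v_n}(p) \in [0, \ln n]$. The convexity statements below are about this function. (1) For every $\alpha \in (0,1) \cup (1,\infty)$, $\|v_2(p)\|_\alpha$ is strictly concave in $H_{v_2}(p) \in [0, \ln 2]$. (2) For every integer $n \ge 3$ and every $\alpha \in [\frac12, 1) \cup (1, \infty)$ there is an inflection point $\chi_n(\alpha) \in (0, \ln n)$ such that $\|v_n(p)\|_\alpha$ is strictly concave in $H_{v_n}(p) \in [0, \chi_n(\alpha)]$ and strictly convex in $H_{v_n}(p) \in [\chi_n(\alpha), \ln n]$. (3) For every integer $n \ge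 3$, the function $\alpha \mapsto \chi_n(\alpha)$ on $[\frac12, 1) \cup (1, \infty)$ satisfies: (a) it is strictly increasing; (b) $\chi_n(\frac12) > \ln n - \left(1 - \frac2n\right) \ln (n-1)$; (c) $\lim_{\alpha \to 1} \chi_n(\alpha) = \ln 2 + \ln \sqrt{n-1}$; (d) $\lim_{\alpha \to \infty} \chi_n(\alpha) = \ln n$. -/

import Mathlib

open Set Filter Topology

noncomputable section

/-- The Shannon entropy (in nats) of a vector `x`, with the convention `0 ln 0 = 0`. -/
def shannonEntropy {n : ℕ} (x : Fin n → ℝ) : ℝ :=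
  -∑ i, x i * Real.log (x i)

/-- The `ℓ_α`-norm `(∑ i, x i ^ α) ^ (1 / α)` of a vector `x` with nonnegative entries,
for a real order `α > 0`. -/
def alphaNorm {n : ℕ} (α : ℝ) (x : Fin n → ℝ) : ℝ :=
  (∑ i, x i ^ α) ^ (1 / α)

/-- The vector `v_n(p) = (1 - (n - 1) p, p, …, p)`. -/
def vVec (n : ℕ) (p : ℝ) : Fin n → ℝ :=
  fun i => if (i : ℕ) = 0 then 1 - ((n : ℝ) - 1) * p else p

/-- `H_{v_n}(p)`, the Shannon entropy of `v_n(p)`. -/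
def entropyV (n : ℕ) (p : ℝ) : ℝ :=
  shannonEntropy (vVec n p)

/-- The inverse function of `H_{v_n}` restricted to `[0, 1/n]`; the restriction is a bijection
onto `[0, ln n]`, see `entropyV_bijOn`. -/
def entropyVInv (n : ℕ) (h : ℝ) : ℝ :=
  Function.invFunOn (entropyV n) (Icc 0 (1 / (n : ℝ))) h

/-- The `ℓ_α`-norm of `v_n(p)`, `p ∈ [0, 1/n]`, as a function of the entropy
`h = H_{v_n}(p) ∈ [0, ln n]`. -/
def normVOfEntropy (n : ℕ) (α : ℝ) (h : ℝ) : ℝ :=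
  alphaNorm α (vVec n (entropyVInv n h))

theorem entropyV_eq (n : ℕ) (hn : 2 ≤ n) (p : ℝ) :
    entropyV n p =
      ((n : ℝ) - 1) * Real.negMulLog p + Real.negMulLog (1 - ((n : ℝ) - 1) * p) := by
  obtain ⟨m, rfl⟩ : ∃ m, n = m + 1 := ⟨n - 1, by omega⟩
  simp only [entropyV, shannonEntropy, vVec, Fin.sum_univ_succ]
  simp [Real.negMulLog]
  ring

theorem entropyV_continuous (n : ℕ) (hn : 2 ≤ n) : Continuous (entropyV n) := by
  have h : entropyV n = fun p =>
      ((n : ℝ) - 1) * Real.negMulLog p + Real.negMulLog (1 - ((n : ℝ) - 1) * p) :=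
    funext (entropyV_eq n hn)
  rw [h]
  have := Real.continuous_negMulLog
  fun_prop

theorem entropyV_strictMonoOn (n : ℕ) (hn : 2 ≤ n) :
    StrictMonoOn (entropyV n) (Icc 0 (1 / (n : ℝ))) := by
  have hn' : (2 : ℝ) ≤ n := by exact_mod_cast hn
  refine strictMonoOn_of_deriv_pos (convex_Icc _ _) (entropyV_continuous n hn).continuousOn ?_
  intro p hp
  rw [interior_Icc] at hp
  obtain ⟨h0, h1⟩ := hp
  have hnp : (n : ℝ) * p < 1 := by
    rw [lt_div_iff₀ (by linarith)] at h1
    linarith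
  have hq : p < 1 - ((n : ℝ) - 1) * p := by linarith
  have hd : HasDerivAt (entropyV n)
      (((n : ℝ) - 1) * (-Real.log p - 1) +
        (-Real.log (1 - ((n : ℝ) - 1) * p) - 1) * (-((n : ℝ) - 1))) p := by
    have e : entropyV n = fun p =>
        ((n : ℝ) - 1) * Real.negMulLog p + Real.negMulLog (1 - ((n : ℝ) - 1) * p) :=
      funext (entropyV_eq n hn)
    rw [e]
    have a := (Real.hasDerivAt_negMulLog h0.ne').const_mul ((n : ℝ) - 1)
    have b : HasDerivAt (fun p : ℝ => 1 - ((n : ℝ) - 1) * p) (-((n : ℝ) - 1)) p := by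
      simpa using ((hasDerivAt_id p).const_mul ((n : ℝ) - 1)).const_sub 1
    have c := (Real.hasDerivAt_negMulLog (x := 1 - ((n : ℝ) - 1) * p) (by linarith)).comp p b
    exact a.add c
  rw [hd.deriv]
  have hl := Real.log_lt_log h0 hq
  nlinarith

/-- `H_{v_n}` maps `[0, 1/n]` bijectively onto `[0, ln n]`. -/
theorem entropyV_bijOn (n : ℕ) (hn : 2 ≤ n) :
    BijOn (entropyV n) (Icc 0 (1 / (n : ℝ))) (Icc 0 (Real.log n)) := by
  have hn' : (2 : ℝ) ≤ n := by exact_mod_cast hn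
  have hpos : (0 : ℝ) < n := by linarith
  have e0 : entropyV n 0 = 0 := by simp [entropyV_eq n hn]
  have e1 : entropyV n (1 / (n : ℝ)) = Real.log n := by
    have : 1 - ((n : ℝ) - 1) * (1 / (n : ℝ)) = 1 / (n : ℝ) := by field_simp; ring
    rw [entropyV_eq n hn, this]
    simp only [Real.negMulLog, one_div, Real.log_inv]
    field_simp
    ring
  have hle : (0 : ℝ) ≤ 1 / (n : ℝ) := by positivity
  have hm := entropyV_strictMonoOn n hn
  refine ⟨fun p hp => ⟨?_, ?_⟩, hm.injOn, ?_⟩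
  · rw [← e0]
    exact hm.monotoneOn (left_mem_Icc.2 hle) hp hp.1
  · rw [← e1]
    exact hm.monotoneOn hp (right_mem_Icc.2 hle) hp.2
  · have := intermediate_value_Icc hle (entropyV_continuous n hn).continuousOn
    rwa [e0, e1] at this

/-- `entropyVInv n` is a two-sided inverse of `H_{v_n} : [0, 1/n] → [0, ln n]`. -/
theorem entropyVInv_invOn (n : ℕ) (hn : 2 ≤ n) :
    InvOn (entropyVInv n) (entropyV n) (Icc 0 (1 / (n : ℝ))) (Icc 0 (Real.log n)) :=
  (entropyV_bijOn n hn).invOn_invFunOn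

end

/-!
Write `m = n - 1`, `q = 1 - m p` and `t = ln (q / p)`, so that `p ↦ t` decreases from `∞` to `0` on
`(0, 1/n)`. Since `dH/dp = m t`, the derivative of the norm with respect to the entropy is a
function of `t` alone,
`G(t) = (e^{αt} + m)^{1/α - 1} (1 - e^{(α-1)t}) / t` (`normDeriv`),
and its derivative in `t` is a positive factor times
`K(α, t) = e^{αt} + m - e^t - m e^{(1-α)t} - (α - 1) t (e^t + m)` (`curvatureSign`).
As `t` decreases when the entropy increases, the norm is strictly concave in the entropy where
`K > 0` and strictly convex where `K < 0`.

For fixed `α` and `m > 1`, both `K` and `∂K/∂t` vanish at `t = 0`, while `e^{-t} ∂²K/∂t²` is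
strictly increasing and negative at `t = 0`. Integrating twice, `K(α, ·)` is first negative and
then positive, with one zero `T(α)` (`exists_sign_change_curvatureSign`); the inflection point
`χ(α)` is the entropy at `t = T(α)`.

For fixed `t`, `K(1, t) = 0` and `∂K/∂α = t (1 - e^{(1-α)t}) (e^{αt} - m)`, whose sign is explicit.
Hence `K(α, t) ≥ 0` forces `K(β, t) > 0` for `β > α`, where `α, β ≠ 1`
(`curvatureSign_pos_of_nonneg`), so `T` is
strictly decreasing. The same formula decides the sign of `K(α, t)` for `α` near `1` according to
whether `e^t` is below or above `m`, so `T(α) → ln m` as `α → 1`; for `α` large `K(α, t) > 0`, so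
`T(α) → 0` as `α → ∞`. The bound at `α = 1/2` is `K(1/2, 2 ln m) > 0`, that is,
`2 (m - 1) / (m + 1) < ln m`. For `m = 1` the sign formula gives `K > 0` throughout.
-/

section
open Real

variable {n : ℕ} {m t α β : ℝ} {T : ℝ → ℝ}

/-! ### Convexity of a function given in parametric form -/

/-- If `f ∘ E = N` with `E` strictly increasing, then `f` is strictly concave as soon as `N' / E'` is
strictly decreasing: by Cauchy's mean value theorem the slopes of `f` are values of `N' / E'`, so
the inverse of `E` need not be differentiated. -/
theorem strictConcaveOn_of_parametrization {f E N E' N' : ℝ → ℝ} {a b : ℝ} (hab : a ≤ b)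
    (hE : ContinuousOn E (Icc a b)) (hN : ContinuousOn N (Icc a b))
    (hmono : StrictMonoOn E (Icc a b))
    (dE : ∀ p ∈ Ioo a b, HasDerivAt E (E' p) p) (dN : ∀ p ∈ Ioo a b, HasDerivAt N (N' p) p)
    (hpos : ∀ p ∈ Ioo a b, 0 < E' p)
    (hanti : StrictAntiOn (fun p => N' p / E' p) (Ioo a b))
    (hf : ∀ p ∈ Icc a b, f (E p) = N p) :
    StrictConcaveOn ℝ (Icc (E a) (E b)) f := by
  have slope : ∀ u ∈ Icc a b, ∀ v ∈ Icc a b, u < v →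
      ∃ c ∈ Ioo u v, (N v - N u) / (E v - E u) = N' c / E' c := by
    intro u hu v hv huv
    have hsub : Icc u v ⊆ Icc a b := Icc_subset_Icc hu.1 hv.2
    have hsub' : Ioo u v ⊆ Ioo a b := Ioo_subset_Ioo hu.1 hv.2
    obtain ⟨c, hc, h⟩ := exists_ratio_hasDerivAt_eq_ratio_slope E E' huv (hE.mono hsub)
      (fun x hx => dE x (hsub' hx)) N N' (hN.mono hsub) (fun x hx => dN x (hsub' hx))
    have h1 : 0 < E v - E u := sub_pos.2 (hmono hu hv huv)
    have h2 := hpos c (hsub' hc)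
    refine ⟨c, hc, ?_⟩
    rw [div_eq_div_iff h1.ne' h2.ne', h, mul_comm]
  have surj := intermediate_value_Icc hab hE
  refine strictConcaveOn_of_slope_strict_anti_adjacent (convex_Icc _ _) ?_
  intro x y z hx hz hxy hyz
  have hy : y ∈ Icc (E a) (E b) := ⟨hx.1.trans hxy.le, hyz.le.trans hz.2⟩
  obtain ⟨u, hu, rfl⟩ := surj hx
  obtain ⟨v, hv, rfl⟩ := surj hy
  obtain ⟨w, hw, rfl⟩ := surj hz
  have huv : u < v := (hmono.lt_iff_lt hu hv).1 hxy
  have hvw : v < w := (hmono.lt_iff_lt hv hw).1 hyz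
  obtain ⟨c, hc, h1⟩ := slope u hu v hv huv
  obtain ⟨d, hd, h2⟩ := slope v hv w hw hvw
  rw [hf u hu, hf v hv, hf w hw, h1, h2]
  exact hanti ⟨hu.1.trans_lt hc.1, hc.2.trans_le hv.2⟩ ⟨hv.1.trans_lt hd.1, hd.2.trans_le hw.2⟩
    (hc.2.trans hd.1)

theorem strictConvexOn_of_parametrization {f E N E' N' : ℝ → ℝ} {a b : ℝ} (hab : a ≤ b)
    (hE : ContinuousOn E (Icc a b)) (hN : ContinuousOn N (Icc a b))
    (hmono : StrictMonoOn E (Icc a b))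
    (dE : ∀ p ∈ Ioo a b, HasDerivAt E (E' p) p) (dN : ∀ p ∈ Ioo a b, HasDerivAt N (N' p) p)
    (hpos : ∀ p ∈ Ioo a b, 0 < E' p)
    (hstrict : StrictMonoOn (fun p => N' p / E' p) (Ioo a b))
    (hf : ∀ p ∈ Icc a b, f (E p) = N p) :
    StrictConvexOn ℝ (Icc (E a) (E b)) f := by
  rw [← neg_strictConcaveOn_iff]
  refine strictConcaveOn_of_parametrization (N := -N) (N' := fun p => -N' p) hab hE hN.neg hmono
    dE (fun p hp => (dN p hp).neg) hpos ?_ (fun p hp => by simp [hf p hp])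
  intro x hx y hy hxy
  have := hstrict hx hy hxy
  simp only [neg_div] at *
  linarith

/-! ### Sign changes of antiderivatives -/

/-- If `f 0 = 0`, `f'` is negative and then positive on `(0, ∞)`, and `f` is positive somewhere, then
`f` itself is negative and then positive. -/
theorem exists_sign_change_of_deriv {f f' : ℝ → ℝ} (hf : ∀ t, HasDerivAt f (f' t) t)
    (h0 : f 0 = 0) {a : ℝ} (ha : 0 < a) (hneg : ∀ t ∈ Ioo 0 a, f' t < 0)
    (hpos : ∀ t, a < t → 0 < f' t) {c : ℝ} (hc : 0 < c) (hfc : 0 < f c) :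
    ∃ b, 0 < b ∧ (∀ t ∈ Ioo 0 b, f t < 0) ∧ f b = 0 ∧ ∀ t, b < t → 0 < f t := by
  have hcont : Continuous f := continuous_iff_continuousAt.2 fun t => (hf t).continuousAt
  have hanti : StrictAntiOn f (Icc 0 a) := by
    refine strictAntiOn_of_deriv_neg (convex_Icc _ _) hcont.continuousOn fun t ht => ?_
    rw [interior_Icc] at ht
    rw [(hf t).deriv]
    exact hneg t ht
  have hmono : StrictMonoOn f (Ici a) := by
    refine strictMonoOn_of_deriv_pos (convex_Ici _) hcont.continuousOn fun t ht => ?_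
    rw [interior_Ici] at ht
    rw [(hf t).deriv]
    exact hpos t ht
  have hle : ∀ t, 0 < t → t ≤ a → f t < 0 := fun t h h' =>
    h0 ▸ hanti ⟨le_rfl, ha.le⟩ ⟨h.le, h'⟩ h
  have hac : a < c := by
    by_contra! h
    exact absurd (hle c hc h) hfc.not_gt
  obtain ⟨b, hb, hb0⟩ := intermediate_value_Icc hac.le hcont.continuousOn
    ⟨(hle a ha le_rfl).le, hfc.le⟩
  refine ⟨b, ha.trans_le hb.1, fun t ht => ?_, hb0, fun t ht => ?_⟩
  · rcases le_or_gt t a with h | h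
    · exact hle t ht.1 h
    · exact hb0 ▸ hmono h.le hb.1 ht.2
  · exact hb0 ▸ hmono hb.1 (hb.1.trans ht.le) ht

theorem exists_deriv_pos_of_pos {f f' : ℝ → ℝ} (hf : ∀ t, HasDerivAt f (f' t) t) (h0 : f 0 = 0)
    {c : ℝ} (hc : 0 < c) (hfc : 0 < f c) : ∃ d, 0 < d ∧ 0 < f' d := by
  obtain ⟨d, hd, h⟩ := exists_hasDerivAt_eq_slope f f' hc
    (fun t _ => (hf t).continuousAt.continuousWithinAt) fun t _ => hf t
  refine ⟨d, hd.1, ?_⟩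
  rw [h, h0]
  simp only [sub_zero]
  positivity

/-! ### The function deciding between concavity and convexity -/

/-- The function `K(α, t)` which, at log-ratio `t = ln (q / p)` and with `m = n - 1`, has the sign of
minus the second derivative of the `ℓ_α`-norm with respect to the entropy. -/
noncomputable def curvatureSign (m α t : ℝ) : ℝ :=
  exp (α * t) + m - exp t - m * exp ((1 - α) * t) - (α - 1) * t * (exp t + m)

theorem hasDerivAt_exp_const_mul (c t : ℝ) :
    HasDerivAt (fun t => exp (c * t)) (c * exp (c * t)) t := by
  have := ((hasDerivAt_id t).const_mul c).exp
  simpa [mul_comm] using this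

theorem exists_curvatureSign_pos {m α : ℝ} (hm : 1 < m) (hα0 : 0 < α) (hα1 : α < 1) :
    ∃ c, 0 < c ∧ 0 < curvatureSign m α c := by
  have h1 : 0 < 1 - α := by linarith
  -- With `(1 - α) c = 1 + m`, the last term of `K` is at least `(1 + m) e^c`.
  refine ⟨(1 + m) / (1 - α), by positivity, ?_⟩
  set c := (1 + m) / (1 - α) with hcdef
  have hc : 0 < c := by positivity
  have h2 : (1 - α) * c = 1 + m := by rw [hcdef]; field_simp
  have h3 : exp ((1 - α) * c) < exp c := exp_lt_exp.2 (by nlinarith)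
  have h4 := exp_pos (α * c)
  have h5 : curvatureSign m α c = exp (α * c) + m - exp c - m * exp ((1 - α) * c)
      + ((1 - α) * c) * (exp c + m) := by unfold curvatureSign; ring
  rw [h5, h2] at *
  nlinarith

/-! ### Dependence on the order for a fixed log-ratio -/

theorem hasDerivAt_curvatureSign_order (m t α : ℝ) :
    HasDerivAt (fun α => curvatureSign m α t)
      (t * (1 - exp ((1 - α) * t)) * (exp (α * t) - m)) α := by
  have h1 : HasDerivAt (fun α => exp (α * t)) (t * exp (α * t)) α := by
    have := ((hasDerivAt_id α).mul_const t).exp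
    simpa [mul_comm] using this
  have h2 : HasDerivAt (fun α => exp ((1 - α) * t)) (-t * exp ((1 - α) * t)) α := by
    have := (((hasDerivAt_id α).const_sub 1).mul_const t).exp
    simpa [mul_comm] using this
  have h3 := ((((hasDerivAt_id α).sub_const 1).mul_const t).mul_const (exp t + m))
  have h := (((h1.add_const m).sub_const (exp t)).sub (h2.const_mul m)).sub h3
  refine h.congr_deriv ?_
  have : exp t = exp ((1 - α) * t) * exp (α * t) := by rw [← exp_add]; congr 1; ring
  rw [this]
  ring

theorem curvatureSign_one (m t : ℝ) : curvatureSign m 1 t = 0 := by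
  simp [curvatureSign]

theorem curvatureSign_continuous_order (m t : ℝ) : Continuous fun α => curvatureSign m α t :=
  continuous_iff_continuousAt.2 fun α => (hasDerivAt_curvatureSign_order m t α).continuousAt

theorem curvatureSign_lt_of_one_le (ht : 0 < t) (hα : 1 ≤ α) (h : m ≤ exp (α * t)) (hαβ : α < β) :
    curvatureSign m α t < curvatureSign m β t := by
  refine strictMonoOn_of_deriv_pos (convex_Icc α β) (curvatureSign_continuous_order m t).continuousOn
    (fun γ hγ => ?_) (left_mem_Icc.2 hαβ.le) (right_mem_Icc.2 hαβ.le) hαβ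
  rw [interior_Icc] at hγ
  rw [(hasDerivAt_curvatureSign_order m t γ).deriv]
  have h1 : exp ((1 - γ) * t) < 1 := exp_lt_one_iff.2 (by nlinarith [hγ.1])
  have h2 : exp (α * t) < exp (γ * t) := exp_lt_exp.2 (by nlinarith [hγ.1])
  exact mul_pos (mul_pos ht (by linarith)) (by linarith)

theorem curvatureSign_lt_of_le_one (ht : 0 < t) (hβ : β ≤ 1) (h : exp (β * t) ≤ m) (hαβ : α < β) :
    curvatureSign m α t < curvatureSign m β t := by
  refine strictMonoOn_of_deriv_pos (convex_Icc α β) (curvatureSign_continuous_order m t).continuousOn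
    (fun γ hγ => ?_) (left_mem_Icc.2 hαβ.le) (right_mem_Icc.2 hαβ.le) hαβ
  rw [interior_Icc] at hγ
  rw [(hasDerivAt_curvatureSign_order m t γ).deriv]
  have h1 : 1 < exp ((1 - γ) * t) := one_lt_exp_iff.2 (by nlinarith [hγ.2])
  have h2 : exp (γ * t) < exp (β * t) := exp_lt_exp.2 (by nlinarith [hγ.2])
  exact mul_pos_of_neg_of_neg (mul_neg_of_pos_of_neg ht (by linarith)) (by linarith)

theorem curvatureSign_pos_of_lt_one (ht : 0 < t) (hα : α < 1) (h : m ≤ exp (α * t)) :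
    0 < curvatureSign m α t := by
  rw [← curvatureSign_one m t]
  refine strictAntiOn_of_deriv_neg (convex_Icc α 1) (curvatureSign_continuous_order m t).continuousOn
    (fun γ hγ => ?_) (left_mem_Icc.2 hα.le) (right_mem_Icc.2 hα.le) hα
  rw [interior_Icc] at hγ
  rw [(hasDerivAt_curvatureSign_order m t γ).deriv]
  have h1 : 1 < exp ((1 - γ) * t) := one_lt_exp_iff.2 (by nlinarith [hγ.2])
  have h2 : exp (α * t) < exp (γ * t) := exp_lt_exp.2 (by nlinarith [hγ.1])
  exact mul_neg_of_neg_of_pos (mul_neg_of_pos_of_neg ht (by linarith)) (by linarith)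

theorem curvatureSign_neg_of_one_lt (ht : 0 < t) (hα : 1 < α) (h : exp (α * t) ≤ m) :
    curvatureSign m α t < 0 := by
  rw [← curvatureSign_one m t]
  refine strictAntiOn_of_deriv_neg (convex_Icc 1 α) (curvatureSign_continuous_order m t).continuousOn
    (fun γ hγ => ?_) (left_mem_Icc.2 hα.le) (right_mem_Icc.2 hα.le) hα
  rw [interior_Icc] at hγ
  rw [(hasDerivAt_curvatureSign_order m t γ).deriv]
  have h1 : exp ((1 - γ) * t) < 1 := exp_lt_one_iff.2 (by nlinarith [hγ.1])
  have h2 : exp (γ * t) < exp (α * t) := exp_lt_exp.2 (by nlinarith [hγ.2])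
  exact mul_neg_of_pos_of_neg (mul_pos ht (by linarith)) (by linarith)

theorem curvatureSign_pos_of_one_lt (ht : 0 < t) (hα : 1 < α) (h : m ≤ exp t) :
    0 < curvatureSign m α t := by
  rw [← curvatureSign_one m t]
  exact curvatureSign_lt_of_one_le ht le_rfl (by simpa using h) hα

theorem curvatureSign_neg_of_lt_one (ht : 0 < t) (hα : α < 1) (h : exp t ≤ m) :
    curvatureSign m α t < 0 := by
  rw [← curvatureSign_one m t]
  exact curvatureSign_lt_of_le_one ht le_rfl (by simpa using h) hα

/-- Once `K(·, t)` is nonnegative it is positive at all larger orders other than `1`; this makes the zero of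
`K(α, ·)` move to the left as `α` increases. -/
theorem curvatureSign_pos_of_nonneg (ht : 0 < t) (hα : α ≠ 1) (hβ : β ≠ 1)
    (hαβ : α < β) (h : 0 ≤ curvatureSign m α t) : 0 < curvatureSign m β t := by
  rcases hα.lt_or_gt with hα | hα
  · have hlog : m < exp t := by
      by_contra! h'
      exact absurd (curvatureSign_neg_of_lt_one ht hα h') h.not_gt
    rcases hβ.lt_or_gt with hβ | hβ
    · rcases le_total m (exp (β * t)) with h' | h'
      · exact curvatureSign_pos_of_lt_one ht hβ h'
      · exact h.trans_lt (curvatureSign_lt_of_le_one ht hβ.le h' hαβ)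
    · exact curvatureSign_pos_of_one_lt ht hβ hlog.le
  · have h' : m ≤ exp (α * t) := by
      by_contra! h'
      exact absurd (curvatureSign_neg_of_one_lt ht hα h'.le) h.not_gt
    exact h.trans_lt (curvatureSign_lt_of_one_le ht hα.le h' hαβ)

theorem curvatureSign_pos_of_large (ht : 0 < t) (hm : 0 < m) (hα : 1 + 2 * m / t < α) :
    0 < curvatureSign m α t := by
  have hs : 2 * m < (α - 1) * t := by
    rw [← div_lt_iff₀ ht]; linarith
  -- In terms of `s = (α - 1) t`, `K ≥ e^t (e^s - 1) - s (e^t + m) ≥ s (s e^t / 2 - m)`.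
  set s := (α - 1) * t with hsdef
  have h1 := quadratic_le_exp_of_nonneg (x := s) (by linarith)
  have h2 : exp ((1 - α) * t) ≤ 1 := exp_le_one_iff.2 (by nlinarith)
  have h3 : exp (α * t) = exp t * exp s := by rw [← exp_add, hsdef]; congr 1; ring
  have h4 : 1 < exp t := one_lt_exp_iff.2 ht
  unfold curvatureSign
  rw [h3, ← hsdef]
  have h5 : exp t * (1 + s + s ^ 2 / 2) ≤ exp t * exp s := by gcongr
  have h6 : m * s < s * s / 2 := by nlinarith
  have h7 : s * s / 2 ≤ exp t * (s * s / 2) := by nlinarith [mul_self_nonneg s]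
  nlinarith

/-! ### The unique sign change in the log-ratio -/

theorem exists_sign_change_curvatureSign (hm : 1 < m) (hα0 : 0 < α) (hα : α ≠ 1) :
    ∃ b, 0 < b ∧ (∀ t ∈ Ioo 0 b, curvatureSign m α t < 0) ∧ curvatureSign m α b = 0 ∧
      ∀ t, b < t → 0 < curvatureSign m α t := by
  obtain ⟨c, hc, hKc⟩ : ∃ c, 0 < c ∧ 0 < curvatureSign m α c := by
    rcases hα.lt_or_gt with h | h
    · exact exists_curvatureSign_pos hm hα0 h
    · exact ⟨log m, log_pos hm, curvatureSign_pos_of_one_lt (log_pos hm) h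
        (by rw [exp_log (by linarith)])⟩
  -- `K1 = ∂K/∂t` and `L = e^{-t} ∂²K/∂t²`.
  set K1 : ℝ → ℝ := fun t => α * exp (α * t) - α * exp t - m * ((1 - α) * exp ((1 - α) * t))
    - (α - 1) * m - (α - 1) * t * exp t with hK1
  set L : ℝ → ℝ := fun t => α ^ 2 * exp ((α - 1) * t) + (1 - 2 * α)
    - m * (1 - α) ^ 2 * exp (-α * t) - (α - 1) * t with hL
  have dK : ∀ t, HasDerivAt (curvatureSign m α) (K1 t) t := by
    intro t
    have h := ((((hasDerivAt_exp_const_mul α t).add_const m).sub (hasDerivAt_exp t)).sub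
      ((hasDerivAt_exp_const_mul (1 - α) t).const_mul m)).sub
      (((hasDerivAt_id t).const_mul (α - 1)).mul ((hasDerivAt_exp t).add_const m))
    refine h.congr_deriv ?_
    simp only [hK1, id]
    ring
  have dK1 : ∀ t, HasDerivAt K1 (exp t * L t) t := by
    intro t
    have h := (((((hasDerivAt_exp_const_mul α t).const_mul α).sub
      ((hasDerivAt_exp t).const_mul α)).sub
      (((hasDerivAt_exp_const_mul (1 - α) t).const_mul (1 - α)).const_mul m)).sub_const
      ((α - 1) * m)).sub (((hasDerivAt_id t).const_mul (α - 1)).mul (hasDerivAt_exp t))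
    refine h.congr_deriv ?_
    have e1 : exp (α * t) = exp t * exp ((α - 1) * t) := by rw [← exp_add]; congr 1; ring
    have e2 : exp ((1 - α) * t) = exp t * exp (-α * t) := by rw [← exp_add]; congr 1; ring
    simp only [hL, id, e1, e2]
    ring
  have dL : ∀ t, HasDerivAt L ((α - 1) * (α ^ 2 * exp ((α - 1) * t) - 1)
      + m * (1 - α) ^ 2 * (α * exp (-α * t))) t := by
    intro t
    have h := ((((hasDerivAt_exp_const_mul (α - 1) t).const_mul (α ^ 2)).add_const
      (1 - 2 * α)).sub ((hasDerivAt_exp_const_mul (-α) t).const_mul (m * (1 - α) ^ 2))).sub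
      ((hasDerivAt_id t).const_mul (α - 1))
    refine h.congr_deriv ?_
    ring
  have cL : Continuous L := continuous_iff_continuousAt.2 fun t => (dL t).continuousAt
  have mL : StrictMonoOn L (Ici 0) := by
    refine strictMonoOn_of_deriv_pos (convex_Ici _) cL.continuousOn fun t ht => ?_
    rw [interior_Ici] at ht
    have ht : 0 < t := ht
    rw [(dL t).deriv]
    have h1 : 0 < m * (1 - α) ^ 2 * (α * exp (-α * t)) := by
      have : 1 - α ≠ 0 := sub_ne_zero.2 hα.symm
      positivity
    have h2 : 0 < (α - 1) * (α ^ 2 * exp ((α - 1) * t) - 1) := by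
      rcases hα.lt_or_gt with h | h
      · have h3 : exp ((α - 1) * t) < 1 := exp_lt_one_iff.2 (by nlinarith)
        have h4 := exp_pos ((α - 1) * t)
        exact mul_pos_of_neg_of_neg (by linarith) (by nlinarith)
      · have h3 : 1 < exp ((α - 1) * t) := one_lt_exp_iff.2 (by nlinarith)
        exact mul_pos (by linarith) (by nlinarith)
    linarith
  have L0 : L 0 < 0 := by
    have : 0 < (1 - α) ^ 2 := by
      have : 1 - α ≠ 0 := sub_ne_zero.2 hα.symm
      positivity
    simp only [hL, mul_zero, exp_zero]
    nlinarith
  have K0 : curvatureSign m α 0 = 0 := by simp [curvatureSign]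
  have K10 : K1 0 = 0 := by simp only [hK1, mul_zero, exp_zero]; ring
  obtain ⟨d, hd, hKd⟩ := exists_deriv_pos_of_pos dK K0 hc hKc
  obtain ⟨e, he, hLe⟩ := exists_deriv_pos_of_pos dK1 K10 hd hKd
  have hLe : 0 < L e := pos_of_mul_pos_right hLe (exp_pos e).le
  obtain ⟨a, ha, hLa⟩ := intermediate_value_Icc he.le cL.continuousOn ⟨L0.le, hLe.le⟩
  have ha0 : 0 < a := by
    refine lt_of_le_of_ne ha.1 ?_
    rintro rfl
    exact L0.ne hLa
  obtain ⟨a', ha', h1, -, h2⟩ := exists_sign_change_of_deriv dK1 K10 ha0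
    (fun t ht => mul_neg_of_pos_of_neg (exp_pos t) (hLa ▸ mL ht.1.le ha.1 ht.2))
    (fun t ht => mul_pos (exp_pos t) (hLa ▸ mL ha.1 (ha.1.trans ht.le) ht)) hd hKd
  exact exists_sign_change_of_deriv dK K0 ha' h1 h2 hc hKc

/-! ### The derivative of the norm with respect to the entropy -/

/-- The derivative of the `ℓ_α`-norm of `vVec` with respect to its entropy, as a function of the
log-ratio `t = ln (q / p)`, with `m = n - 1`; see `alphaNorm_deriv_div_entropyV_deriv`. -/
noncomputable def normDeriv (m α t : ℝ) : ℝ :=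
  (exp (α * t) + m) ^ (1 / α - 1) * (1 - exp ((α - 1) * t)) / t

theorem hasDerivAt_normDeriv {m α t : ℝ} (hm : 0 < m) (hα : α ≠ 0) (ht : t ≠ 0) :
    HasDerivAt (normDeriv m α)
      ((exp (α * t) + m) ^ (1 / α - 1 - 1) * exp ((α - 1) * t) / t ^ 2 * curvatureSign m α t) t := by
  have hS : 0 < exp (α * t) + m := by positivity
  have h := ((((hasDerivAt_exp_const_mul α t).add_const m).rpow_const
    (p := 1 / α - 1) (Or.inl hS.ne')).mul
      ((hasDerivAt_exp_const_mul (α - 1) t).const_sub 1)).div (hasDerivAt_id t) ht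
  refine h.congr_deriv ?_
  have e0 : (exp (α * t) + m) ^ (1 / α - 1) =
      (exp (α * t) + m) ^ (1 / α - 1 - 1) * (exp (α * t) + m) := by
    rw [rpow_sub_one hS.ne' (1 / α - 1)]
    field_simp
  have e1 : exp (α * t) = exp t * exp ((α - 1) * t) := by rw [← exp_add]; congr 1; ring
  have e2 : exp ((1 - α) * t) = (exp ((α - 1) * t))⁻¹ := by rw [← exp_neg]; congr 1; ring
  have e3 : α * (1 / α - 1) = 1 - α := by field_simp
  simp only [id, Pi.mul_apply]
  rw [e0]
  generalize (exp (α * t) + m) ^ (1 / α - 1 - 1) = A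
  unfold curvatureSign
  rw [e2, e1]
  have hX := exp_pos ((α - 1) * t)
  generalize exp ((α - 1) * t) = X at *
  generalize exp t = Z at *
  have e4 : α * (Z * X) * (1 / α - 1) = (1 - α) * (Z * X) := by rw [← e3]; ring
  rw [e4]
  field_simp
  ring

theorem normDeriv_strictMonoOn {m α T : ℝ} (hm : 0 < m) (hα : α ≠ 0) (hT : 0 ≤ T)
    (h : ∀ t, T < t → 0 < curvatureSign m α t) : StrictMonoOn (normDeriv m α) (Ioi T) := by
  have hd : ∀ t ∈ Ioi T, HasDerivAt (normDeriv m α) _ t := fun t (ht : T < t) =>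
    hasDerivAt_normDeriv hm hα (hT.trans_lt ht).ne'
  refine strictMonoOn_of_deriv_pos (convex_Ioi T)
    (fun t ht => (hd t ht).continuousAt.continuousWithinAt) fun t ht => ?_
  rw [interior_Ioi] at ht
  rw [(hd t ht).deriv]
  have h1 := h t ht
  have h2 : 0 < t := hT.trans_lt ht
  positivity

theorem normDeriv_strictAntiOn {m α T : ℝ} (hm : 0 < m) (hα : α ≠ 0)
    (h : ∀ t ∈ Ioo 0 T, curvatureSign m α t < 0) : StrictAntiOn (normDeriv m α) (Ioo 0 T) := by
  have hd : ∀ t ∈ Ioo 0 T, HasDerivAt (normDeriv m α) _ t := fun t ht =>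
    hasDerivAt_normDeriv hm hα ht.1.ne'
  refine strictAntiOn_of_deriv_neg (convex_Ioo 0 T)
    (fun t ht => (hd t ht).continuousAt.continuousWithinAt) fun t ht => ?_
  rw [interior_Ioo] at ht
  rw [(hd t ht).deriv]
  have h2 : 0 < t := ht.1
  exact mul_neg_of_pos_of_neg (by positivity) (h t ht)

/-! ### The log-ratio parameter -/

/-- The log-ratio `ln (q / p)` of the two distinct entries `q = 1 - m p` and `p` of `vVec`. -/
noncomputable def logRatio (m p : ℝ) : ℝ := log (1 - m * p) - log p

/-- The probability `p` with log-ratio `t`, the inverse of `logRatio m` on `0 < p`, `m p < 1`. -/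
noncomputable def ofLogRatio (m t : ℝ) : ℝ := 1 / (exp t + m)

theorem ofLogRatio_zero (n : ℕ) : ofLogRatio ((n : ℝ) - 1) 0 = 1 / (n : ℝ) := by
  simp [ofLogRatio]

theorem ofLogRatio_pos {m : ℝ} (hm : 0 < m) (t : ℝ) : 0 < ofLogRatio m t := by
  unfold ofLogRatio; positivity

theorem ofLogRatio_strictAnti {m : ℝ} (hm : 0 < m) : StrictAnti (ofLogRatio m) := by
  intro s t hst
  have := exp_lt_exp.2 hst
  unfold ofLogRatio
  gcongr

theorem logRatio_lt_iff {m p t : ℝ} (hm : 0 < m) (hp : 0 < p) (hq : 0 < 1 - m * p) :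
    logRatio m p < t ↔ ofLogRatio m t < p := by
  have h : 0 < exp t + m := by positivity
  rw [logRatio, ← log_div hq.ne' hp.ne', log_lt_iff_lt_exp (by positivity), div_lt_iff₀ hp,
    ofLogRatio, div_lt_iff₀ h]
  constructor <;> intro <;> nlinarith

theorem lt_logRatio_iff {m p t : ℝ} (hm : 0 < m) (hp : 0 < p) (hq : 0 < 1 - m * p) :
    t < logRatio m p ↔ p < ofLogRatio m t := by
  have h : 0 < exp t + m := by positivity
  rw [logRatio, ← log_div hq.ne' hp.ne', lt_log_iff_exp_lt (by positivity), lt_div_iff₀ hp,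
    ofLogRatio, lt_div_iff₀ h]
  constructor <;> intro <;> nlinarith

theorem logRatio_lt_logRatio {m p r : ℝ} (hm : 0 < m) (hp : 0 < p) (hpr : p < r)
    (hr : 0 < 1 - m * r) : logRatio m r < logRatio m p := by
  have h1 := log_lt_log hp hpr
  have h2 : log (1 - m * r) < log (1 - m * p) := log_lt_log hr (by nlinarith)
  unfold logRatio
  linarith

/-! ### Entropy and norm of `vVec` -/

theorem alphaNorm_vVec (n : ℕ) (hn : 2 ≤ n) (α p : ℝ) :
    alphaNorm α (vVec n p) =
      ((1 - ((n : ℝ) - 1) * p) ^ α + ((n : ℝ) - 1) * p ^ α) ^ (1 / α) := by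
  obtain ⟨k, rfl⟩ : ∃ k, n = k + 1 := ⟨n - 1, by omega⟩
  simp [alphaNorm, vVec, Fin.sum_univ_succ]

theorem hasDerivAt_entropyV (hn : 2 ≤ n) {p : ℝ} (hp : 0 < p) (hq : 0 < 1 - ((n : ℝ) - 1) * p) :
    HasDerivAt (entropyV n) (((n : ℝ) - 1) * logRatio ((n : ℝ) - 1) p) p := by
  rw [show entropyV n = _ from funext (entropyV_eq n hn)]
  have a := (hasDerivAt_negMulLog hp.ne').const_mul ((n : ℝ) - 1)
  have b : HasDerivAt (fun p : ℝ => 1 - ((n : ℝ) - 1) * p) (-((n : ℝ) - 1)) p := by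
    simpa using ((hasDerivAt_id p).const_mul ((n : ℝ) - 1)).const_sub 1
  have c := (hasDerivAt_negMulLog (x := 1 - ((n : ℝ) - 1) * p) hq.ne').comp p b
  refine (a.add c).congr_deriv ?_
  unfold logRatio
  ring

theorem hasDerivAt_alphaNorm_vVec (hn : 2 ≤ n) {α p : ℝ} (hα : α ≠ 0) (hp : 0 < p)
    (hq : 0 < 1 - ((n : ℝ) - 1) * p) :
    HasDerivAt (fun p => alphaNorm α (vVec n p))
      (((n : ℝ) - 1) * ((1 - ((n : ℝ) - 1) * p) ^ α + ((n : ℝ) - 1) * p ^ α) ^ (1 / α - 1) *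
        (p ^ (α - 1) - (1 - ((n : ℝ) - 1) * p) ^ (α - 1))) p := by
  have hn' : (2 : ℝ) ≤ n := by exact_mod_cast hn
  have hm : 0 < (n : ℝ) - 1 := by linarith
  rw [show (fun p => alphaNorm α (vVec n p)) = _ from funext (alphaNorm_vVec n hn α)]
  generalize (n : ℝ) - 1 = m at *
  have hS : 0 < (1 - m * p) ^ α + m * p ^ α := by positivity
  have b : HasDerivAt (fun p : ℝ => 1 - m * p) (-m) p := by
    simpa using ((hasDerivAt_id p).const_mul m).const_sub 1
  have h := ((b.rpow_const (p := α) (Or.inl hq.ne')).add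
    ((hasDerivAt_rpow_const (p := α) (Or.inl hp.ne')).const_mul m)).rpow_const
      (p := 1 / α) (Or.inl hS.ne')
  refine h.congr_deriv ?_
  simp only [Pi.add_apply]
  field_simp
  ring

theorem alphaNorm_deriv_div_entropyV_deriv {m α p : ℝ} (hm : 0 < m) (hα : α ≠ 0) (hp : 0 < p)
    (hq : 0 < 1 - m * p) :
    m * ((1 - m * p) ^ α + m * p ^ α) ^ (1 / α - 1) * (p ^ (α - 1) - (1 - m * p) ^ (α - 1)) /
      (m * logRatio m p) = normDeriv m α (logRatio m p) := by
  -- Everything is homogeneous in `p`: factor out `p` from `q = p e^t`.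
  have hpq : 1 - m * p = p * exp (logRatio m p) := by
    rw [logRatio, exp_sub, exp_log hq, exp_log hp]; field_simp
  generalize logRatio m p = t at *
  rw [hpq, mul_rpow hp.le (exp_pos t).le, mul_rpow hp.le (exp_pos t).le, ← exp_mul, ← exp_mul,
    mul_comm t α, mul_comm t (α - 1),
    show p ^ α * exp (α * t) + m * p ^ α = p ^ α * (exp (α * t) + m) by ring,
    mul_rpow (by positivity) (by positivity), ← rpow_mul hp.le, mul_assoc m, mul_div_mul_left _ _ hm.ne',
    normDeriv]
  congr 1
  have e : p ^ (α * (1 / α - 1)) * p ^ (α - 1) = 1 := by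
    rw [← rpow_add hp, show α * (1 / α - 1) + (α - 1) = 0 by field_simp; ring, rpow_zero]
  linear_combination (exp (α * t) + m) ^ (1 / α - 1) * (1 - exp ((α - 1) * t)) * e

theorem continuous_alphaNorm_vVec (hn : 2 ≤ n) {α : ℝ} (hα : 0 < α) :
    Continuous fun p => alphaNorm α (vVec n p) := by
  rw [show (fun p => alphaNorm α (vVec n p)) = _ from funext (alphaNorm_vVec n hn α)]
  have h : 0 ≤ 1 / α := by positivity
  refine Continuous.rpow_const ?_ fun _ => Or.inr h
  exact ((by fun_prop : Continuous fun p : ℝ => 1 - ((n : ℝ) - 1) * p).rpow_const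
    fun _ => Or.inr hα.le).add (continuous_const.mul (continuous_id.rpow_const fun _ => Or.inr hα.le))

theorem normVOfEntropy_entropyV (hn : 2 ≤ n) (α : ℝ) {p : ℝ} (hp : p ∈ Icc 0 (1 / (n : ℝ))) :
    normVOfEntropy n α (entropyV n p) = alphaNorm α (vVec n p) := by
  rw [normVOfEntropy, (entropyVInv_invOn n hn).1 hp]

theorem entropyV_zero (hn : 2 ≤ n) : entropyV n 0 = 0 := by simp [entropyV_eq n hn]

theorem entropyV_one_div (hn : 2 ≤ n) : entropyV n (1 / (n : ℝ)) = log n := by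
  have hpos : (0 : ℝ) < n := by positivity
  have : 1 - ((n : ℝ) - 1) * (1 / (n : ℝ)) = 1 / (n : ℝ) := by field_simp; ring
  rw [entropyV_eq n hn, this]
  simp only [negMulLog, one_div, log_inv]
  field_simp
  ring

theorem one_sub_pos_of_lt_one_div (hn : 2 ≤ n) {p : ℝ} (hp : 0 < p) (h : p < 1 / (n : ℝ)) :
    0 < 1 - ((n : ℝ) - 1) * p := by
  have hpos : (0 : ℝ) < n := by positivity
  rw [lt_div_iff₀ hpos] at h
  linarith

theorem logRatio_pos_of_lt_one_div (hn : 2 ≤ n) {p : ℝ} (hp : 0 < p) (h : p < 1 / (n : ℝ)) :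
    0 < logRatio ((n : ℝ) - 1) p := by
  have hn' : (2 : ℝ) ≤ n := by exact_mod_cast hn
  rw [lt_logRatio_iff (by linarith) hp (one_sub_pos_of_lt_one_div hn hp h), ofLogRatio_zero]
  exact h

theorem ofLogRatio_le_one_div (hn : 2 ≤ n) {t : ℝ} (ht : 0 ≤ t) :
    ofLogRatio ((n : ℝ) - 1) t ≤ 1 / (n : ℝ) := by
  have hn' : (2 : ℝ) ≤ n := by exact_mod_cast hn
  rw [← ofLogRatio_zero]
  exact (ofLogRatio_strictAnti (by linarith)).antitone ht

/-! ### Concavity and convexity of the norm -/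

theorem strictConcaveOn_normVOfEntropy (hn : 2 ≤ n) {α T : ℝ} (hα : 0 < α) (hT : 0 ≤ T)
    (h : ∀ t, T < t → 0 < curvatureSign ((n : ℝ) - 1) α t) :
    StrictConcaveOn ℝ (Icc 0 (entropyV n (ofLogRatio ((n : ℝ) - 1) T))) (normVOfEntropy n α) := by
  have hn' : (2 : ℝ) ≤ n := by exact_mod_cast hn
  have hm : 0 < (n : ℝ) - 1 := by linarith
  have hle := ofLogRatio_le_one_div hn hT
  have hq : ∀ p ∈ Ioo 0 (ofLogRatio ((n : ℝ) - 1) T), 0 < 1 - ((n : ℝ) - 1) * p := fun p hp =>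
    one_sub_pos_of_lt_one_div hn hp.1 (hp.2.trans_le hle)
  rw [← entropyV_zero hn]
  refine strictConcaveOn_of_parametrization (ofLogRatio_pos hm T).le
    (entropyV_continuous n hn).continuousOn (continuous_alphaNorm_vVec hn hα).continuousOn
    ((entropyV_strictMonoOn n hn).mono (Icc_subset_Icc le_rfl hle))
    (fun p hp => hasDerivAt_entropyV hn hp.1 (hq p hp))
    (fun p hp => hasDerivAt_alphaNorm_vVec hn hα.ne' hp.1 (hq p hp))
    (fun p hp => mul_pos hm (logRatio_pos_of_lt_one_div hn hp.1 (hp.2.trans_le hle)))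
    ?_ (fun p hp => normVOfEntropy_entropyV hn α (Icc_subset_Icc le_rfl hle hp))
  intro p hp r hr hpr
  simp only [alphaNorm_deriv_div_entropyV_deriv hm hα.ne' hp.1 (hq p hp),
    alphaNorm_deriv_div_entropyV_deriv hm hα.ne' hr.1 (hq r hr)]
  exact normDeriv_strictMonoOn hm hα.ne' hT h ((lt_logRatio_iff hm hr.1 (hq r hr)).2 hr.2)
    ((lt_logRatio_iff hm hp.1 (hq p hp)).2 hp.2) (logRatio_lt_logRatio hm hp.1 hpr (hq r hr))

theorem strictConvexOn_normVOfEntropy (hn : 2 ≤ n) {α T : ℝ} (hα : 0 < α) (hT : 0 ≤ T)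
    (h : ∀ t ∈ Ioo 0 T, curvatureSign ((n : ℝ) - 1) α t < 0) :
    StrictConvexOn ℝ (Icc (entropyV n (ofLogRatio ((n : ℝ) - 1) T)) (log n))
      (normVOfEntropy n α) := by
  have hn' : (2 : ℝ) ≤ n := by exact_mod_cast hn
  have hm : 0 < (n : ℝ) - 1 := by linarith
  have hle := ofLogRatio_le_one_div hn hT
  have h0 := ofLogRatio_pos hm T
  have hp0 : ∀ p ∈ Ioo (ofLogRatio ((n : ℝ) - 1) T) (1 / (n : ℝ)), 0 < p := fun p hp =>
    h0.trans hp.1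
  have hq : ∀ p ∈ Ioo (ofLogRatio ((n : ℝ) - 1) T) (1 / (n : ℝ)), 0 < 1 - ((n : ℝ) - 1) * p :=
    fun p hp => one_sub_pos_of_lt_one_div hn (hp0 p hp) hp.2
  rw [← entropyV_one_div hn]
  refine strictConvexOn_of_parametrization hle
    (entropyV_continuous n hn).continuousOn (continuous_alphaNorm_vVec hn hα).continuousOn
    ((entropyV_strictMonoOn n hn).mono (Icc_subset_Icc h0.le le_rfl))
    (fun p hp => hasDerivAt_entropyV hn (hp0 p hp) (hq p hp))
    (fun p hp => hasDerivAt_alphaNorm_vVec hn hα.ne' (hp0 p hp) (hq p hp))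
    (fun p hp => mul_pos hm (logRatio_pos_of_lt_one_div hn (hp0 p hp) hp.2))
    ?_ (fun p hp => normVOfEntropy_entropyV hn α (Icc_subset_Icc h0.le le_rfl hp))
  intro p hp r hr hpr
  simp only [alphaNorm_deriv_div_entropyV_deriv hm hα.ne' (hp0 p hp) (hq p hp),
    alphaNorm_deriv_div_entropyV_deriv hm hα.ne' (hp0 r hr) (hq r hr)]
  exact normDeriv_strictAntiOn hm hα.ne' h
    ⟨logRatio_pos_of_lt_one_div hn (hp0 r hr) hr.2,
      (logRatio_lt_iff hm (hp0 r hr) (hq r hr)).2 hr.1⟩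
    ⟨logRatio_pos_of_lt_one_div hn (hp0 p hp) hp.2,
      (logRatio_lt_iff hm (hp0 p hp) (hq p hp)).2 hp.1⟩
    (logRatio_lt_logRatio hm (hp0 p hp) hpr (hq r hr))

/-! ### The entropy as a function of the log-ratio -/

theorem continuous_entropyV_ofLogRatio (hn : 2 ≤ n) :
    Continuous fun t => entropyV n (ofLogRatio ((n : ℝ) - 1) t) := by
  have hn' : (2 : ℝ) ≤ n := by exact_mod_cast hn
  refine (entropyV_continuous n hn).comp ?_
  unfold ofLogRatio
  refine continuous_const.div (by fun_prop) fun t => ?_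
  have := exp_pos t
  linarith

theorem entropyV_ofLogRatio_lt (hn : 2 ≤ n) {s t : ℝ} (hs : 0 ≤ s) (hst : s < t) :
    entropyV n (ofLogRatio ((n : ℝ) - 1) t) < entropyV n (ofLogRatio ((n : ℝ) - 1) s) := by
  have hn' : (2 : ℝ) ≤ n := by exact_mod_cast hn
  have hm : 0 < (n : ℝ) - 1 := by linarith
  exact entropyV_strictMonoOn n hn
    ⟨(ofLogRatio_pos hm t).le, ofLogRatio_le_one_div hn (hs.trans hst.le)⟩
    ⟨(ofLogRatio_pos hm s).le, ofLogRatio_le_one_div hn hs⟩ (ofLogRatio_strictAnti hm hst)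

/-- At `t = ln m` the entries are `q = 1/2` and `p = 1/(2m)`. -/
theorem entropyV_ofLogRatio_log (hn : 2 ≤ n) :
    entropyV n (ofLogRatio ((n : ℝ) - 1) (log ((n : ℝ) - 1))) =
      log 2 + log (√((n : ℝ) - 1)) := by
  have hn' : (2 : ℝ) ≤ n := by exact_mod_cast hn
  have hm : 0 < (n : ℝ) - 1 := by linarith
  rw [entropyV_eq n hn, ofLogRatio, exp_log hm, log_sqrt hm.le]
  generalize (n : ℝ) - 1 = m at *
  rw [show 1 - m * (1 / (m + m)) = 2⁻¹ by field_simp; ring,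
    show 1 / (m + m) = (2 * m)⁻¹ by field_simp; ring]
  simp only [negMulLog, log_inv]
  rw [log_mul (by norm_num) hm.ne']
  field_simp
  ring

/-- At `t = 2 ln m` the entries are `q = (n-1)/n` and `p = 1/(n(n-1))`. -/
theorem entropyV_ofLogRatio_two_mul_log (hn : 2 ≤ n) :
    entropyV n (ofLogRatio ((n : ℝ) - 1) (2 * log ((n : ℝ) - 1))) =
      log n - (1 - 2 / (n : ℝ)) * log ((n : ℝ) - 1) := by
  have hn' : (2 : ℝ) ≤ n := by exact_mod_cast hn
  have hm : 0 < (n : ℝ) - 1 := by linarith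
  have e : exp (2 * log ((n : ℝ) - 1)) = ((n : ℝ) - 1) ^ 2 := by
    rw [two_mul, exp_add, exp_log hm, sq]
  rw [entropyV_eq n hn, ofLogRatio, e]
  obtain ⟨m, hmn⟩ : ∃ m : ℝ, m = (n : ℝ) - 1 := ⟨_, rfl⟩
  have hnm : (n : ℝ) = m + 1 := by linarith
  rw [← hmn] at hm ⊢
  rw [hnm, show 1 - m * (1 / (m ^ 2 + m)) = m / (m + 1) by field_simp; ring,
    show 1 / (m ^ 2 + m) = (m * (m + 1))⁻¹ by field_simp]
  simp only [negMulLog, log_inv]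
  rw [log_mul hm.ne' (by positivity), log_div hm.ne' (by positivity)]
  field_simp
  ring

/-! ### Location of the sign change -/

theorem curvatureSign_half_pos (hm : 1 < m) : 0 < curvatureSign m (1 / 2) (2 * log m) := by
  have hm0 : 0 < m := by linarith
  have e1 : exp (2 * log m) = m ^ 2 := by rw [two_mul, exp_add, exp_log hm0, sq]
  have e2 : exp (1 / 2 * (2 * log m)) = m := by
    rw [show 1 / 2 * (2 * log m) = log m by ring, exp_log hm0]
  have e3 : exp ((1 - 1 / 2) * (2 * log m)) = m := by
    rw [show (1 - 1 / 2) * (2 * log m) = log m by ring, exp_log hm0]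
  rw [curvatureSign, e1, e2, e3]
  have h : 2 * (m - 1) / (m + 1) < log m := by
    have := lt_log_one_add_of_pos (x := m - 1) (by linarith)
    rwa [show m - 1 + 2 = m + 1 by ring, show 1 + (m - 1) = m by ring] at this
  rw [div_lt_iff₀ (by linarith)] at h
  have h' := mul_pos hm0 (sub_pos.2 h)
  linarith

/-- Here and below, `T α` stands for the zero of `K(α, ·)`, used only through its comparison with
the points where `K(α, ·)` is positive or negative. -/
theorem tendsto_log_of_crossing (hm : 1 < m)
    (hlt : ∀ α, 0 < α → α ≠ 1 → ∀ t, 0 < t → 0 < curvatureSign m α t → T α < t)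
    (hgt : ∀ α, 0 < α → α ≠ 1 → ∀ t, 0 < t → curvatureSign m α t < 0 → t < T α)
    (hT : ∀ α, 0 < α → α ≠ 1 → 0 < T α) : Tendsto T (𝓝[≠] 1) (𝓝 (log m)) := by
  have hm0 : 0 < m := by linarith
  have h0 : ∀ᶠ α : ℝ in 𝓝[≠] 1, 0 < α :=
    eventually_nhdsWithin_of_eventually_nhds (eventually_gt_nhds one_pos)
  have hc : ∀ t : ℝ, Tendsto (fun α => exp (α * t)) (𝓝[≠] 1) (𝓝 (exp t)) := fun t => by
    have : Continuous fun α => exp (α * t) := by fun_prop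
    simpa using (this.tendsto 1).mono_left nhdsWithin_le_nhds
  refine tendsto_order.2 ⟨fun t ht => ?_, fun t ht => ?_⟩
  · rcases le_or_gt t 0 with h | ht0
    · filter_upwards [h0, self_mem_nhdsWithin] with α hα hα1
      exact h.trans_lt (hT α hα hα1)
    have htm : exp t < m := (lt_log_iff_exp_lt hm0).1 ht
    filter_upwards [h0, self_mem_nhdsWithin, (hc t).eventually_lt_const htm] with α hα hα1 h
    refine hgt α hα hα1 t ht0 ?_
    rcases lt_or_gt_of_ne hα1 with h1 | h1
    · exact curvatureSign_neg_of_lt_one ht0 h1 htm.le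
    · exact curvatureSign_neg_of_one_lt ht0 h1 h.le
  · have ht0 : 0 < t := (log_pos hm).trans ht
    have htm : m < exp t := (log_lt_iff_lt_exp hm0).1 ht
    filter_upwards [h0, self_mem_nhdsWithin, (hc t).eventually_const_lt htm] with α hα hα1 h
    refine hlt α hα hα1 t ht0 ?_
    rcases lt_or_gt_of_ne hα1 with h1 | h1
    · exact curvatureSign_pos_of_lt_one ht0 h1 h.le
    · exact curvatureSign_pos_of_one_lt ht0 h1 htm.le

theorem tendsto_zero_of_crossing (hm : 0 < m)
    (hlt : ∀ α, 0 < α → α ≠ 1 → ∀ t, 0 < t → 0 < curvatureSign m α t → T α < t)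
    (hT : ∀ α, 0 < α → α ≠ 1 → 0 < T α) : Tendsto T atTop (𝓝 0) := by
  refine tendsto_order.2 ⟨fun t ht => ?_, fun t ht => ?_⟩
  · filter_upwards [eventually_gt_atTop 1] with α hα
    exact ht.trans (hT α (by linarith) hα.ne')
  · filter_upwards [eventually_gt_atTop 1, eventually_gt_atTop (1 + 2 * m / t)] with α hα h
    exact hlt α (by linarith) hα.ne' t ht (curvatureSign_pos_of_large ht hm h)

end

/-! ### The inflection point -/

theorem lemma2 :
    (∀ α ∈ Ioo (0 : ℝ) 1 ∪ Ioi 1,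
      StrictConcaveOn ℝ (Icc 0 (Real.log 2)) (normVOfEntropy 2 α)) ∧
    (∀ n : ℕ, 3 ≤ n → ∃ χ : ℝ → ℝ,
      (∀ α ∈ Ico (1 / 2 : ℝ) 1 ∪ Ioi 1,
        χ α ∈ Ioo 0 (Real.log n) ∧
        StrictConcaveOn ℝ (Icc 0 (χ α)) (normVOfEntropy n α) ∧
        StrictConvexOn ℝ (Icc (χ α) (Real.log n)) (normVOfEntropy n α)) ∧
      StrictMonoOn χ (Ico (1 / 2 : ℝ) 1 ∪ Ioi 1) ∧
      Real.log n - (1 - 2 / (n : ℝ)) * Real.log ((n : ℝ) - 1) < χ (1 / 2) ∧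
      Tendsto χ (𝓝[≠] 1) (𝓝 (Real.log 2 + Real.log (Real.sqrt ((n : ℝ) - 1)))) ∧
      Tendsto χ atTop (𝓝 (Real.log n))) := by
  refine ⟨fun α hα => ?_, fun n hn => ?_⟩
  -- For `n = 2`, `m = 1` and the log-ratio `0` corresponds to `p = 1/2`.
  · have hα0 : 0 < α := by
      rcases hα with h | h
      · exact h.1
      · exact one_pos.trans h
    have h := strictConcaveOn_normVOfEntropy (n := 2) le_rfl hα0 le_rfl fun t ht => ?_
    · rw [ofLogRatio_zero, entropyV_one_div le_rfl] at h
      exact_mod_cast h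
    · have e : ((2 : ℕ) : ℝ) - 1 = 1 := by norm_num
      rw [e]
      rcases hα with h | h
      · exact curvatureSign_pos_of_lt_one ht h.2 (Real.one_le_exp (by positivity))
      · exact curvatureSign_pos_of_one_lt ht h (Real.one_le_exp ht.le)
  · have hn2 : 2 ≤ n := by omega
    have hn' : (3 : ℝ) ≤ n := by exact_mod_cast hn
    have hm : 1 < (n : ℝ) - 1 := by linarith
    have hm0 : 0 < (n : ℝ) - 1 := by linarith
    have hex : ∀ α : ℝ, ∃ b, 0 < α → α ≠ 1 → 0 < b ∧
        (∀ t ∈ Ioo 0 b, curvatureSign ((n : ℝ) - 1) α t < 0) ∧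
        curvatureSign ((n : ℝ) - 1) α b = 0 ∧
        ∀ t, b < t → 0 < curvatureSign ((n : ℝ) - 1) α t := by
      intro α
      by_cases h : 0 < α ∧ α ≠ 1
      · obtain ⟨b, hb⟩ := exists_sign_change_curvatureSign hm h.1 h.2
        exact ⟨b, fun _ _ => hb⟩
      · exact ⟨0, fun h1 h2 => absurd ⟨h1, h2⟩ h⟩
    -- `T α` is the sign change of `K(α, ·)`; its value at `α ≤ 0` and `α = 1` plays no role.
    choose T hT using hex
    have hlt : ∀ α, 0 < α → α ≠ 1 → ∀ t, 0 < t → 0 < curvatureSign ((n : ℝ) - 1) α t →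
        T α < t := by
      intro α h0 h1 t ht h
      obtain ⟨-, hneg, hz, -⟩ := hT α h0 h1
      by_contra! hle
      rcases hle.eq_or_lt with e | hlt
      · rw [e, hz] at h; exact h.false
      · exact h.not_gt (hneg t ⟨ht, hlt⟩)
    have hgt : ∀ α, 0 < α → α ≠ 1 → ∀ t, 0 < t → curvatureSign ((n : ℝ) - 1) α t < 0 →
        t < T α := by
      intro α h0 h1 t ht h
      obtain ⟨-, -, hz, hpos⟩ := hT α h0 h1
      by_contra! hle
      rcases hle.eq_or_lt with e | hlt
      · rw [← e, hz] at h; exact h.false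
      · exact h.not_gt (hpos t hlt)
    have hdom : ∀ α ∈ Ico (1 / 2 : ℝ) 1 ∪ Ioi 1, 0 < α ∧ α ≠ 1 := by
      rintro α (h | h)
      · exact ⟨by linarith [h.1], h.2.ne⟩
      · exact ⟨one_pos.trans h, ne_of_gt h⟩
    have hTpos : ∀ α, 0 < α → α ≠ 1 → 0 < T α := fun α h0 h1 => (hT α h0 h1).1
    have hcont := continuous_entropyV_ofLogRatio hn2
    refine ⟨fun α => entropyV n (ofLogRatio ((n : ℝ) - 1) (T α)), fun α hα => ?_,
      fun α hα β hβ hαβ => ?_, ?_, ?_, ?_⟩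
    · obtain ⟨h0, h1⟩ := hdom α hα
      obtain ⟨hb, hneg, -, hpos⟩ := hT α h0 h1
      refine ⟨⟨?_, ?_⟩, strictConcaveOn_normVOfEntropy hn2 h0 hb.le hpos,
        strictConvexOn_normVOfEntropy hn2 h0 hb.le hneg⟩
      · rw [← entropyV_zero hn2]
        have hp := ofLogRatio_pos hm0 (T α)
        exact entropyV_strictMonoOn n hn2 (left_mem_Icc.2 (by positivity))
          ⟨hp.le, ofLogRatio_le_one_div hn2 hb.le⟩ hp
      · rw [← entropyV_one_div hn2, ← ofLogRatio_zero]
        exact entropyV_ofLogRatio_lt hn2 le_rfl hb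
    · obtain ⟨hα0, hα1⟩ := hdom α hα
      obtain ⟨hβ0, hβ1⟩ := hdom β hβ
      obtain ⟨hb, -, hz, -⟩ := hT α hα0 hα1
      exact entropyV_ofLogRatio_lt hn2 (hTpos β hβ0 hβ1).le (hlt β hβ0 hβ1 (T α) hb
        (curvatureSign_pos_of_nonneg hb hα1 hβ1 hαβ hz.ge))
    · rw [← entropyV_ofLogRatio_two_mul_log hn2]
      have h0 : (0 : ℝ) < 1 / 2 := by norm_num
      have h1 : (1 / 2 : ℝ) ≠ 1 := by norm_num
      exact entropyV_ofLogRatio_lt hn2 (hTpos _ h0 h1).le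
        (hlt _ h0 h1 _ (mul_pos two_pos (Real.log_pos hm)) (curvatureSign_half_pos hm))
    · rw [← entropyV_ofLogRatio_log hn2]
      exact (hcont.tendsto _).comp (tendsto_log_of_crossing hm hlt hgt hTpos)
    · have h := (hcont.tendsto 0).comp (tendsto_zero_of_crossing hm0 hlt hTpos)
      rwa [ofLogRatio_zero, entropyV_one_div hn2] at h
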